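/- Let $M$ be a finite von Neumann algebra with a faithful normal tracial state $\tau$. For a von Neumann subalgebra $A\subseteq M$ (containing the unit of $M$), let $E_A : M\to A$ denote the unique $\tau$-preserving conditional expectation. For positive linear functionals $\psi,\phi$ (not necessarily normal) on a unital $C^*$-algebra $C$, let $S(\psi,\phi)\in(-\infty,\infty]$ denote the relative entropy $$S(\psi,\phi)=-\langle \xi_\psi,\log\Delta_{\phi,\psi}\,\xi_\psi\rangle ,$$ where $\xi_\psi$ is the cyclic vector of the GNS representation of $\psi$ and the relative modular operator $\Delta_{\phi,\psi}$ is the positive self-adjoint operator on the GNS space of $\psi$ associated with the closable part of the quadratic form $x\xi_\psi\mapsto\phi(xx^*)$, $x\in C$. Equivalently, on the Hilbert space completion of $C$ for $\langle x,y\rangle=\psi(x^*y)+\phi(yx^*)$ let $T$ be the positive contraction with $\langle x,Ty\rangle=\psi(x^*y)$, and let $\mu$ be its spectral measure at the vector $1\in C$; then $S(\psi,\phi)=\int_{[0,1]}\lambda\,(\log\lambda-\log(1-\lambda))\,d\mu(\lambda)$, where the integrand is $0$ at $\lambda=0$ and $+\infty$ at $\lambda=1$. Let $A$ and $B$ be von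 Neumann subalgebras of $M$, and let $\psi,\phi$ be positive linear functionals on $M$. If $E_AE_B=E_BE_A$, then $$S\big((\psi\circ E_A)|_B,\ (\phi\circ E_A)|_B\big)=S\big((\psi\circ E_A)|_{A\cap B},\ (\phi\circ E_A)|_{A\cap B}\big).$$ -/

import Mathlib

open scoped ComplexOrder InnerProductSpace

noncomputable section

/-! ### Von Neumann algebras as C⋆-algebras -/

namespace VonNeumannAlgebra

variable {H : Type*} [NormedAddCommGroup H] [InnerProductSpace ℂ H] [CompleteSpace H]

instance instSMulMemClass : SMulMemClass (VonNeumannAlgebra H) ℂ (H →L[ℂ] H) where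
  smul_mem {S} c _ hx := S.toStarSubalgebra.smul_mem hx c

/-- A von Neumann algebra is norm closed; hence it is a C⋆-algebra. -/
instance instIsClosed (M : VonNeumannAlgebra H) : IsClosed (M : Set (H →L[ℂ] H)) := by
  rw [← M.centralizer_centralizer]
  exact Set.isClosed_centralizer _

/-- The positive elements of a von Neumann algebra (those which are positive operators)
are the elements of the form `y⋆y` with `y` in the algebra. -/
instance instStarOrderedRing (M : VonNeumannAlgebra H) : StarOrderedRing M := by
  refine StarOrderedRing.of_le_iff fun x y => ⟨fun h => ?_, ?_⟩
  · have h0 : 0 ≤ ((y : H →L[ℂ] H) - x) := sub_nonneg.mpr h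
    have hmem : CFC.sqrt ((y : H →L[ℂ] H) - x) ∈ M := by
      rw [CFC.sqrt_eq_real_sqrt _ h0]
      exact cfcₙ_mem _ (sub_mem y.2 x.2)
    refine ⟨⟨_, hmem⟩, Subtype.ext ?_⟩
    have h1 : star (CFC.sqrt ((y : H →L[ℂ] H) - x)) = CFC.sqrt ((y : H →L[ℂ] H) - x) :=
      (IsSelfAdjoint.of_nonneg (CFC.sqrt_nonneg _)).star_eq
    change (y : H →L[ℂ] H) = x + star (CFC.sqrt ((y : H →L[ℂ] H) - x)) * CFC.sqrt _
    rw [h1, CFC.sqrt_mul_sqrt_self _ h0]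
    abel
  · rintro ⟨s, rfl⟩
    change (x : H →L[ℂ] H) ≤ x + star (s : H →L[ℂ] H) * s
    exact le_add_of_nonneg_right (star_mul_self_nonneg _)

/-- The intersection `A ⊓ B` of two von Neumann algebras on the same Hilbert space. -/
instance instSemilatticeInf : SemilatticeInf (VonNeumannAlgebra H) where
  inf A B :=
    { toStarSubalgebra := A.toStarSubalgebra ⊓ B.toStarSubalgebra
      centralizer_centralizer' := by
        refine Set.Subset.antisymm (fun x hx => ⟨?_, ?_⟩) Set.subset_centralizer_centralizer
        · have h : x ∈ Set.centralizer (Set.centralizer (A : Set (H →L[ℂ] H))) :=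
            Set.centralizer_subset (Set.centralizer_subset fun _ h => h.1) hx
          rwa [A.centralizer_centralizer] at h
        · have h : x ∈ Set.centralizer (Set.centralizer (B : Set (H →L[ℂ] H))) :=
            Set.centralizer_subset (Set.centralizer_subset fun _ h => h.2) hx
          rwa [B.centralizer_centralizer] at h }
  inf_le_left _ _ _ h := h.1
  inf_le_right _ _ _ h := h.2
  le_inf _ _ _ h₁ h₂ _ h := ⟨h₁ h, h₂ h⟩

/-- The inclusion of a von Neumann subalgebra `N ⊆ M`, as a positive linear map. -/
def inclusion {N M : VonNeumannAlgebra H} (h : N ≤ M) : N →ₚ[ℂ] M where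
  toFun x := ⟨x, h x.2⟩
  map_add' _ _ := rfl
  map_smul' _ _ := rfl
  monotone' _ _ hxy := hxy

/-- The restriction `ψ|_N` of a positive linear functional on `M` to a von Neumann
subalgebra `N`. -/
def restrict {N M : VonNeumannAlgebra H} (ψ : M →ₚ[ℂ] ℂ) (h : N ≤ M) : N →ₚ[ℂ] ℂ :=
  ψ.comp (inclusion h)

/-- `τ` is a faithful normal tracial state on the von Neumann algebra `M`. -/
structure IsFaithfulNormalTracialState {M : VonNeumannAlgebra H} (τ : M →ₚ[ℂ] ℂ) : Prop where
  map_one : τ 1 = 1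
  tracial : ∀ x y : M, τ (x * y) = τ (y * x)
  faithful : ∀ x : M, 0 ≤ x → τ x = 0 → x = 0
  /-- Normality: `τ` preserves suprema of bounded upward directed sets of positive elements. -/
  normal : ∀ (D : Set M) (x : M), D.Nonempty → (∀ d ∈ D, 0 ≤ d) → DirectedOn (· ≤ ·) D →
    IsLUB D x → IsLUB (τ '' D) (τ x)

/-- `E`, viewed as a map `M → M` with range `A`, is the `τ`-preserving conditional expectation
of `M` onto the von Neumann subalgebra `A`: a positive linear `A`-bimodule projection of `M`
onto `A` with `τ ∘ E = τ`. -/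
structure IsCondExp {M : VonNeumannAlgebra H} (τ : M →ₚ[ℂ] ℂ) (A : VonNeumannAlgebra H)
    (E : M →ₚ[ℂ] M) : Prop where
  apply_mem : ∀ x : M, (E x : H →L[ℂ] H) ∈ A
  apply_of_mem : ∀ a : M, (a : H →L[ℂ] H) ∈ A → E a = a
  bimodule : ∀ a x b : M, (a : H →L[ℂ] H) ∈ A → (b : H →L[ℂ] H) ∈ A →
    E (a * x * b) = a * E x * b
  preserves : ∀ x : M, τ (E x) = τ x

end VonNeumannAlgebra

/-! ### Relative entropy of positive linear functionals on a unital C⋆-algebra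

For a positive functional `ψ` let `ξ_ψ` be its GNS vector in the GNS space `ψ.GNS`, so that
`‖x ξ_ψ‖² = ψ (x⋆ x)`. The relative modular operator `Δ = Δ_{φ,ψ}` is the positive self-adjoint
operator in `ψ.GNS` associated with (the closable part of) the quadratic form
`x ξ_ψ ↦ φ (x x⋆)`. The form Hilbert space, with `‖x‖² = ψ (x⋆ x) + φ (x x⋆)`, is
`FormSpace ψ φ`; if `J` is its canonical contraction into `ψ.GNS`, then `J J⋆ = (1 + Δ)⁻¹`. With
`T = J⋆ J` and `Λ` the class of `1` in the form space, `J Λ = ξ_ψ` and hence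
`⟪Λ, g(T) T Λ⟫ = ⟪ξ_ψ, g((1 + Δ)⁻¹) ξ_ψ⟫` for bounded Borel `g`. As
`-log Δ = log λ - log (1 - λ)` at `λ = (1 + Δ)⁻¹`, Araki's relative entropy
`S(ψ, φ) = -⟪ξ_ψ, log Δ_{φ,ψ} ξ_ψ⟫` is the integral of `λ (log λ - log (1 - λ))`
against the spectral measure of `T` at `Λ`. -/

namespace PositiveLinearMap

variable {C : Type*} [CStarAlgebra C] [PartialOrder C]

set_option linter.unusedVariables false in
/-- The algebra `C` with the semi-inner product `⟨x, y⟩ = ψ (x⋆ y) + φ (y x⋆)`. -/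
@[nolint unusedArguments]
def PreFormSpace (ψ φ : C →ₚ[ℂ] ℂ) := C

variable (ψ φ : C →ₚ[ℂ] ℂ)

instance : AddCommGroup (PreFormSpace ψ φ) := inferInstanceAs (AddCommGroup C)
instance : Module ℂ (PreFormSpace ψ φ) := inferInstanceAs (Module ℂ C)

/-- The identity map from `C` to `PreFormSpace ψ φ`. -/
def toPreFormSpace : C ≃ₗ[ℂ] PreFormSpace ψ φ := LinearEquiv.refl ℂ _

variable [StarOrderedRing C]

/-- The semi-inner product `⟨x, y⟩ = ψ (x⋆ y) + φ (y x⋆)`. -/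
abbrev formCore : PreInnerProductSpace.Core ℂ (PreFormSpace ψ φ) where
  inner x y :=
    ψ (star ((toPreFormSpace ψ φ).symm x) * (toPreFormSpace ψ φ).symm y) +
      φ ((toPreFormSpace ψ φ).symm y * star ((toPreFormSpace ψ φ).symm x))
  conj_inner_symm := by simp [← Complex.star_def, ← map_star]
  re_inner_nonneg _ := (RCLike.nonneg_iff.mp (add_nonneg
    (ψ.map_nonneg (star_mul_self_nonneg _)) (φ.map_nonneg (mul_star_self_nonneg _)))).1
  add_left _ _ _ := by simp only [map_add, star_add, add_mul, mul_add]; ring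
  smul_left := by simp [mul_add]

instance : SeminormedAddCommGroup (PreFormSpace ψ φ) :=
  InnerProductSpace.Core.toSeminormedAddCommGroup (c := formCore ψ φ)
instance : InnerProductSpace ℂ (PreFormSpace ψ φ) :=
  InnerProductSpace.ofCore (formCore ψ φ)

/-- The Hilbert space completion of `C` for `⟨x, y⟩ = ψ (x⋆ y) + φ (y x⋆)`. -/
abbrev FormSpace := UniformSpace.Completion (PreFormSpace ψ φ)

/-- The vector of the form space given by the unit of `C`. -/
def formVector : FormSpace ψ φ := (toPreFormSpace ψ φ 1 : PreFormSpace ψ φ)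

/-- The contraction from the form space to the GNS space of `ψ` that maps the class of `x`
to `x ξ_ψ`. -/
def formToGNS : FormSpace ψ φ →L[ℂ] ψ.GNS :=
  (LinearMap.mkContinuous
    (ψ.toPreGNS.toLinearMap ∘ₗ (toPreFormSpace ψ φ).symm.toLinearMap) 1 (fun x => by
      rw [one_mul]
      refine Real.sqrt_le_sqrt ?_
      have h := (RCLike.nonneg_iff.mp (φ.map_nonneg
        (mul_star_self_nonneg ((toPreFormSpace ψ φ).symm x)))).1
      change (ψ (_ * _)).re ≤ (ψ (_ * _) + φ (_ * _)).re
      rw [Complex.add_re]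
      exact le_add_of_nonneg_right h)).completion

/-- The positive contraction `T` on the form space with `⟪x, T y⟫ = ψ (x⋆ y)` and
`⟪x, (1 - T) y⟫ = φ (y x⋆)` for `x, y ∈ C`. -/
def formOperator : FormSpace ψ φ →L[ℂ] FormSpace ψ φ :=
  (formToGNS ψ φ).adjoint ∘L formToGNS ψ φ

/-- The function `λ (log λ - log (1 - λ))` with the singularity at `λ = 1` cut off: `1 - λ` is
replaced by `max (1 - λ) (1 / (n + 1))`. On `[0, 1]` it increases with `n`. -/
def entropyCutoff (n : ℕ) (t : ℝ) : ℝ :=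
  t * (Real.log t - Real.log (max (1 - t) (1 / ((n : ℝ) + 1))))

/-- The relative entropy `S(ψ, φ) = -⟪ξ_ψ, log Δ_{φ,ψ} ξ_ψ⟫ ∈ (-∞, ∞]` of two positive linear
functionals on a unital C⋆-algebra: the integral of `λ (log λ - log (1 - λ))` against the
spectral measure of `T` at the vector of the unit, which by monotone convergence is the
supremum of the integrals of the cut-off functions. -/
def relativeEntropy : EReal :=
  ⨆ n : ℕ, ((⟪formVector ψ φ,
    cfc (entropyCutoff n) (formOperator ψ φ) (formVector ψ φ)⟫_ℂ).re : EReal)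

end PositiveLinearMap

end

/-! Commutation of the expectations makes `E_A` map `B` into `A ⊓ B`, so `E_A` restricts to an
expectation of `B` onto `A ⊓ B` through which both functionals factor. The inclusion then induces an
isometry `V` of form spaces whose adjoint is induced by `E_A`. It satisfies `T V = V T'` and carries
the vector of the unit to the vector of the unit. Hence `f(T) V = V f(T')` for continuous `f`, and
moving `V` across the inner product equates the two entropy integrals for each cutoff, hence their
suprema (`relativeEntropy_eq_of_expectation`). -/

section Intertwining

variable {E F : Type*} [NormedAddCommGroup E] [InnerProductSpace ℂ E]
  [NormedAddCommGroup F] [InnerProductSpace ℂ F]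

/-- An operator intertwining `S` and `T` intertwines polynomials in `S` and `T`. -/
theorem ContinuousLinearMap.aeval_comp_of_comp_eq {S : E →L[ℂ] E} {T : F →L[ℂ] F}
    {V : E →L[ℂ] F} (h : T ∘L V = V ∘L S) (p : Polynomial ℝ) :
    Polynomial.aeval T p ∘L V = V ∘L Polynomial.aeval S p := by
  induction p using Polynomial.induction_on' with
  | add p q hp hq =>
    rw [map_add, map_add, ContinuousLinearMap.add_comp, ContinuousLinearMap.comp_add, hp, hq]
  | monomial n r =>
    have hpow : ∀ x, (T ^ n) (V x) = V ((S ^ n) x) := by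
      induction n with
      | zero => intro x; rfl
      | succ n ih =>
        intro x
        have hx : T (V x) = V (S x) := DFunLike.congr_fun h x
        rw [pow_succ, pow_succ, mul_apply_eq_comp, mul_apply_eq_comp, hx, ih]
    ext x
    rw [Polynomial.aeval_monomial, Polynomial.aeval_monomial, ← Algebra.smul_def,
      ← Algebra.smul_def]
    change r • (T ^ n) (V x) = V (r • (S ^ n) x)
    rw [hpow, ← Complex.coe_smul, ← Complex.coe_smul, map_smul]

variable [CompleteSpace E] [CompleteSpace F]

/-- Both spectra lie in one interval `[-R, R]`, so a single Weierstrass approximant serves both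
operators. -/
theorem ContinuousLinearMap.exists_polynomial_aeval_near_cfc {S : E →L[ℂ] E} {T : F →L[ℂ] F}
    (hS : IsSelfAdjoint S) (hT : IsSelfAdjoint T) {f : ℝ → ℝ} (hf : Continuous f)
    {ε : ℝ} (hε : 0 < ε) :
    ∃ p : Polynomial ℝ, ‖cfc f S - Polynomial.aeval S p‖ ≤ ε ∧
      ‖cfc f T - Polynomial.aeval T p‖ ≤ ε := by
  obtain ⟨R, hR⟩ := ((spectrum.isBounded S (𝕜 := ℝ)).union
    (spectrum.isBounded T (𝕜 := ℝ))).subset_closedBall 0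
  obtain ⟨p, hp⟩ := exists_polynomial_near_of_continuousOn (-R) R f hf.continuousOn ε hε
  have hb : ∀ x ∈ spectrum ℝ S ∪ spectrum ℝ T, ‖f x - p.eval x‖ ≤ ε := fun x hx => by
    have hx' : ‖x‖ ≤ R := by simpa using hR hx
    rw [Real.norm_eq_abs, abs_sub_comm]
    exact (hp x (abs_le.mp hx')).le
  refine ⟨p, ?_, ?_⟩
  · rw [← cfc_polynomial p S hS, ← cfc_sub f _ S hf.continuousOn p.continuous.continuousOn]
    exact norm_cfc_le hε.le fun x hx => hb x (Or.inl hx)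
  · rw [← cfc_polynomial p T hT, ← cfc_sub f _ T hf.continuousOn p.continuous.continuousOn]
    exact norm_cfc_le hε.le fun x hx => hb x (Or.inr hx)

/-- An operator intertwining self-adjoint operators `S` and `T` intertwines continuous functions
of `S` and `T`. -/
theorem ContinuousLinearMap.cfc_comp_of_comp_eq {S : E →L[ℂ] E} {T : F →L[ℂ] F}
    {V : E →L[ℂ] F} (hS : IsSelfAdjoint S) (hT : IsSelfAdjoint T) (h : T ∘L V = V ∘L S)
    {f : ℝ → ℝ} (hf : Continuous f) : cfc f T ∘L V = V ∘L cfc f S := by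
  rw [← sub_eq_zero, ← norm_le_zero_iff]
  refine le_of_forall_pos_le_add fun ε hε => ?_
  -- Each of two error terms costs at most `δ * ‖V‖`; the `+ 1` covers `V = 0`.
  obtain ⟨p, hpS, hpT⟩ := exists_polynomial_aeval_near_cfc hS hT hf
    (ε := ε / (2 * (‖V‖ + 1))) (by positivity)
  have key : cfc f T ∘L V - V ∘L cfc f S =
      (cfc f T - Polynomial.aeval T p) ∘L V - V ∘L (cfc f S - Polynomial.aeval S p) := by
    rw [ContinuousLinearMap.sub_comp, ContinuousLinearMap.comp_sub, aeval_comp_of_comp_eq h]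
    abel
  set δ := ε / (2 * (‖V‖ + 1)) with hδ
  have hδε : δ * (2 * (‖V‖ + 1)) = ε := div_mul_cancel₀ _ (by positivity)
  have hδ0 : 0 ≤ δ := by positivity
  calc ‖cfc f T ∘L V - V ∘L cfc f S‖
      ≤ ‖cfc f T - Polynomial.aeval T p‖ * ‖V‖ + ‖V‖ * ‖cfc f S - Polynomial.aeval S p‖ := by
        rw [key]
        exact (norm_sub_le _ _).trans
          (add_le_add (opNorm_comp_le _ _) (opNorm_comp_le _ _))
    _ ≤ δ * ‖V‖ + ‖V‖ * δ := by gcongr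
    _ ≤ 0 + ε := by linarith

end Intertwining

namespace PositiveLinearMap

/-- `t log t` extends continuously by `0` at `t = 0`, and the cutoff keeps the other logarithm's
argument at least `1 / (n + 1)`. -/
theorem continuous_entropyCutoff (n : ℕ) : Continuous (entropyCutoff n) := by
  have h : entropyCutoff n = fun t : ℝ =>
      t * Real.log t - t * Real.log (max (1 - t) (1 / ((n : ℝ) + 1))) :=
    funext fun t => mul_sub _ _ _
  rw [h]
  refine Real.continuous_mul_log.sub (continuous_id.mul (Continuous.log (by fun_prop) fun t => ?_))
  exact (lt_max_of_lt_right (by positivity)).ne'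

variable {C D : Type*} [CStarAlgebra C] [PartialOrder C] [StarOrderedRing C]
  [CStarAlgebra D] [PartialOrder D] [StarOrderedRing D]

theorem inner_toPreFormSpace (ψ φ : C →ₚ[ℂ] ℂ) (x y : C) :
    ⟪toPreFormSpace ψ φ x, toPreFormSpace ψ φ y⟫_ℂ = ψ (star x * y) + φ (y * star x) :=
  rfl

theorem formToGNS_coe (ψ φ : C →ₚ[ℂ] ℂ) (x : C) :
    formToGNS ψ φ (toPreFormSpace ψ φ x : PreFormSpace ψ φ) = (ψ.toPreGNS x : ψ.PreGNS) :=
  ContinuousLinearMap.completion_apply_coe _ _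

theorem inner_formOperator_coe (ψ φ : C →ₚ[ℂ] ℂ) (x y : C) :
    ⟪((toPreFormSpace ψ φ x : PreFormSpace ψ φ) : FormSpace ψ φ),
      formOperator ψ φ (toPreFormSpace ψ φ y : PreFormSpace ψ φ)⟫_ℂ = ψ (star x * y) := by
  rw [formOperator, ContinuousLinearMap.comp_apply, ContinuousLinearMap.adjoint_inner_right,
    formToGNS_coe, formToGNS_coe, UniformSpace.Completion.inner_coe]
  rfl

theorem isSelfAdjoint_formOperator (ψ φ : C →ₚ[ℂ] ℂ) : IsSelfAdjoint (formOperator ψ φ) :=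
  (ContinuousLinearMap.isPositive_adjoint_comp_self (formToGNS ψ φ)).isSelfAdjoint

theorem FormSpace.induction_on {ψ φ : C →ₚ[ℂ] ℂ} {p : FormSpace ψ φ → Prop} (z : FormSpace ψ φ)
    (hp : IsClosed {z | p z}) (h : ∀ x : C, p (toPreFormSpace ψ φ x : PreFormSpace ψ φ)) : p z :=
  UniformSpace.Completion.induction_on z hp h

/-- Relative entropy does not change on passing to a subalgebra through which both functionals
factor by a conditional expectation `E`. -/
theorem relativeEntropy_eq_of_expectation {ψ φ : C →ₚ[ℂ] ℂ} {ψ' φ' : D →ₚ[ℂ] ℂ}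
    (ι : D →ₗ[ℂ] C) (E : C → D) (hι : ι 1 = 1) (hE : ∀ d, E (ι d) = d)
    (hψ : ∀ x d, ψ (star x * ι d) = ψ' (star (E x) * d))
    (hφ : ∀ x d, φ (ι d * star x) = φ' (d * star (E x))) :
    relativeEntropy ψ φ = relativeEntropy ψ' φ' := by
  -- By `hψ`, `hφ` and `hE` at `x = ι d`, `ι` preserves the form norm exactly; the bound `1`
  -- suffices to extend it to the completion.
  let V : FormSpace ψ' φ' →L[ℂ] FormSpace ψ φ :=
    (LinearMap.mkContinuous ((toPreFormSpace ψ φ).toLinearMap ∘ₗ ι ∘ₗ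
      (toPreFormSpace ψ' φ').symm.toLinearMap) 1 (fun d => by
        rw [one_mul]
        refine Real.sqrt_le_sqrt (le_of_eq ?_)
        change (ψ (star (ι ((toPreFormSpace ψ' φ').symm d)) * _) + φ (_ * star _)).re =
          (ψ' (_ * _) + φ' (_ * _)).re
        erw [hψ, hφ, hE]
        rfl)).completion
  have hV : ∀ d : D, V (toPreFormSpace ψ' φ' d : PreFormSpace ψ' φ') =
      (toPreFormSpace ψ φ (ι d) : PreFormSpace ψ φ) := fun d =>
    ContinuousLinearMap.completion_apply_coe _ _
  -- The adjoint of `V` sends the class of `x` to that of `E x`.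
  have hadj : ∀ (x : C) (z : FormSpace ψ' φ'),
      ⟪((toPreFormSpace ψ φ x : PreFormSpace ψ φ) : FormSpace ψ φ), V z⟫_ℂ =
        ⟪((toPreFormSpace ψ' φ' (E x) : PreFormSpace ψ' φ') : FormSpace ψ' φ'), z⟫_ℂ := by
    intro x z
    induction z using FormSpace.induction_on with
    | hp => exact isClosed_eq (by fun_prop) (by fun_prop)
    | h d =>
      rw [hV, UniformSpace.Completion.inner_coe, UniformSpace.Completion.inner_coe,
        inner_toPreFormSpace, inner_toPreFormSpace, hψ, hφ]
  -- Paired with `x`, the two sides at `d` give `ψ (star x * ι d)` and `ψ' (star (E x) * d)`.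
  have hTV : formOperator ψ φ ∘L V = V ∘L formOperator ψ' φ' := by
    ext z
    induction z using FormSpace.induction_on with
    | hp => exact isClosed_eq (by fun_prop) (by fun_prop)
    | h d =>
      refine ext_inner_left ℂ fun w => ?_
      induction w using FormSpace.induction_on with
      | hp => exact isClosed_eq (by fun_prop) (by fun_prop)
      | h x =>
        rw [ContinuousLinearMap.comp_apply, ContinuousLinearMap.comp_apply, hadj, hV,
          inner_formOperator_coe, inner_formOperator_coe, hψ]
  have hΛ : V (formVector ψ' φ') = formVector ψ φ := by
    rw [formVector, hV, hι, formVector]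
  have hE1 : E 1 = 1 := by rw [← hι, hE]
  refine iSup_congr fun n => ?_
  have hc := DFunLike.congr_fun (ContinuousLinearMap.cfc_comp_of_comp_eq
    (isSelfAdjoint_formOperator ψ' φ') (isSelfAdjoint_formOperator ψ φ) hTV
    (continuous_entropyCutoff n)) (formVector ψ' φ')
  rw [ContinuousLinearMap.comp_apply, ContinuousLinearMap.comp_apply, hΛ] at hc
  rw [hc]
  conv_lhs => rw [formVector]
  rw [hadj, hE1, ← formVector]

end PositiveLinearMap

namespace VonNeumannAlgebra.IsCondExp

variable {H : Type*} [NormedAddCommGroup H] [InnerProductSpace ℂ H] [CompleteSpace H]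
  {M A : VonNeumannAlgebra H} {τ : M →ₚ[ℂ] ℂ} {E : M →ₚ[ℂ] M}

theorem apply_mul_of_mem (hE : IsCondExp τ A E) (x : M) {a : M} (ha : (a : H →L[ℂ] H) ∈ A) :
    E (x * a) = E x * a := by
  simpa using hE.bimodule 1 x a (one_mem A) ha

theorem apply_of_mem_mul (hE : IsCondExp τ A E) (x : M) {a : M} (ha : (a : H →L[ℂ] H) ∈ A) :
    E (a * x) = a * E x := by
  simpa using hE.bimodule a x 1 ha (one_mem A)

end VonNeumannAlgebra.IsCondExp

theorem lemma2p2p1 {H : Type*} [NormedAddCommGroup H] [InnerProductSpace ℂ H] [CompleteSpace H]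
    (M : VonNeumannAlgebra H) (τ : M →ₚ[ℂ] ℂ)
    (hτ : VonNeumannAlgebra.IsFaithfulNormalTracialState τ)
    (A B : VonNeumannAlgebra H) (hA : A ≤ M) (hB : B ≤ M)
    (E_A E_B : M →ₚ[ℂ] M)
    (hE_A : VonNeumannAlgebra.IsCondExp τ A E_A) (hE_B : VonNeumannAlgebra.IsCondExp τ B E_B)
    (hcomm : E_A.comp E_B = E_B.comp E_A)
    (ψ φ : M →ₚ[ℂ] ℂ) :
    PositiveLinearMap.relativeEntropy
        (VonNeumannAlgebra.restrict (ψ.comp E_A) hB)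
        (VonNeumannAlgebra.restrict (φ.comp E_A) hB) =
      PositiveLinearMap.relativeEntropy
        (VonNeumannAlgebra.restrict (ψ.comp E_A) (inf_le_right.trans hB : A ⊓ B ≤ M))
        (VonNeumannAlgebra.restrict (φ.comp E_A) (inf_le_right.trans hB : A ⊓ B ≤ M)) := by
  -- For `b ∈ B`, `E_A b = E_A (E_B b) = E_B (E_A b)` lies in `B` as well as `A`.
  have hmem : ∀ b : M, (b : H →L[ℂ] H) ∈ B → (E_A b : H →L[ℂ] H) ∈ A ⊓ B := fun b hb => by
    have h : E_A (E_B b) = E_B (E_A b) := DFunLike.congr_fun hcomm b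
    rw [hE_B.apply_of_mem b hb] at h
    refine ⟨hE_A.apply_mem b, ?_⟩
    rw [h]
    exact hE_B.apply_mem _
  have hstar : ∀ x : M, E_A (star x) = star (E_A x) := map_star E_A
  refine PositiveLinearMap.relativeEntropy_eq_of_expectation
    (VonNeumannAlgebra.inclusion (inf_le_right : A ⊓ B ≤ B)).toLinearMap
    (fun x => ⟨E_A ⟨x, hB x.2⟩, hmem _ x.2⟩) rfl ?_ ?_ ?_
  · intro d
    have h := congrArg Subtype.val (hE_A.apply_of_mem ⟨d, hB d.2.2⟩ d.2.1)
    exact Subtype.ext h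
  · intro x d
    change ψ (E_A (star ⟨x, hB x.2⟩ * ⟨d, hB d.2.2⟩)) =
      ψ (E_A (star (E_A ⟨x, hB x.2⟩) * ⟨d, hB d.2.2⟩))
    -- As `d ∈ A` leaves the expectation and `E_A` is idempotent, both sides become `ψ (star (E_A x)
    -- * d)`.
    rw [hE_A.apply_mul_of_mem _ d.2.1, hE_A.apply_mul_of_mem _ d.2.1, hstar, hstar,
      hE_A.apply_of_mem _ (hE_A.apply_mem _)]
  · intro x d
    change φ (E_A (⟨d, hB d.2.2⟩ * star ⟨x, hB x.2⟩)) =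
      φ (E_A (⟨d, hB d.2.2⟩ * star (E_A ⟨x, hB x.2⟩)))
    rw [hE_A.apply_of_mem_mul _ d.2.1, hE_A.apply_of_mem_mul _ d.2.1, hstar, hstar,
      hE_A.apply_of_mem _ (hE_A.apply_mem _)]
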